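/- Let $f_1,\dots,f_m:\mathbb R^n\to\mathbb R$ be convex and let $X_1,\dots,X_m\subset\mathbb R^n$ be compact and convex, with $\bigcap_{i=1}^m X_i$ having non-empty interior. Put $f=\sum_{i=1}^m f_i$ and suppose that the subgradients of $f$ are bounded on $\bigcup_{i=1}^m X_i$, i.e. there is $L<\infty$ with $\|\xi\|_2\le L$ for all $x\in\bigcup_{i} X_i$ and $\xi\in\partial f(x)$. Consider the problem $$\text{minimise } f(x)\quad\text{subject to } x\in\textstyle\bigcap_{i=1}^m X_i .\qquad(\mathrm P)$$ For $k=0,1,2,\dots$ let $A(k)$ be a real $m\times m$ matrix, with $[A(k)]^i_j$ its entry in row $j$ and column $i$. Agent $j$ sends information to agent $i$ at time $k$ if $[A(k)]_j^i>0$; let $\mathcal E_\infty$ be the set of pairs $(j,i)$ such that $j$ sends information to $i$ at infinitely many times $k$. Assume that: (i) the directed graph $(\{1,\dots,m\},\mathcal E_\infty)$ is strongly connected, and there is $T\in\mathbb N$ such that for each $(j,i)\in\mathcal E_\infty$, agent $j$ sends information to agent $i$ at least once in every $T$ consecutive iterations; (ii) there is $\eta\in(0,1)$ such that, for all $k,i,j$,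 $[A(k)]_i^i\ge\eta$, and $[A(k)]_j^i\ge\eta$ whenever $[A(k)]_j^i>0$; (iii) each $A(k)$ is doubly stochastic. Let $(c(k))_{k\ge0}$ be non-negative and non-increasing with $\sum_k c(k)=\infty$ and $\sum_k c(k)^2<\infty$ (for example $c(k)=\beta/(k+1)$ with $\beta>0$). Starting from arbitrary $x_i(0)\in X_i$, let the sequences satisfy, for all $k\ge0$ and $i=1,\dots,m$, $$z_i(k)=\sum_{j=1}^m[A(k)]_j^i\,x_j(k),\qquad g_i(k)\in\partial f_i(z_i(k)),\qquad d_i(k)=\sum_{j=1}^m[A(k)]_j^i\,g_j(k),$$ $$x_i(k+1)=\operatorname*{arg\,min}_{\xi\in X_i}\ d_i(k)^{T}\xi+\frac1{2c(k)}\|z_i(k)-\xi\|_2^2 .$$ Then there is a minimiser $x^\star$ of $(\mathrm P)$, the same for all agents, such that $$\lim_{k\to\infty}\|x_i(k)-x^\star\|_2=0\qquad\text{for all } i=1,\dots,m.$$ -/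

import Mathlib

open Filter Topology

namespace SubgradAvg

/-- The subdifferential `∂h(x)` of a real-valued function `h` on `ℝⁿ`: the set of all `g` with
`h x + ⟨g, y - x⟩ ≤ h y` for every `y`. -/
def subdifferential {n : ℕ} (h : EuclideanSpace ℝ (Fin n) → ℝ) (x : EuclideanSpace ℝ (Fin n)) :
    Set (EuclideanSpace ℝ (Fin n)) :=
  {g | ∀ y, h x + inner ℝ g (y - x) ≤ h y}

/-- The global objective `f = ∑ i, f i`. -/
noncomputable def objective {n m : ℕ} (f : Fin m → EuclideanSpace ℝ (Fin n) → ℝ)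
    (x : EuclideanSpace ℝ (Fin n)) : ℝ :=
  ∑ i, f i x

/-- `xs` is a minimiser of `f = ∑ i, f i` over the feasible set `⋂ i, X i`. -/
def IsMinimiser {n m : ℕ} (f : Fin m → EuclideanSpace ℝ (Fin n) → ℝ)
    (X : Fin m → Set (EuclideanSpace ℝ (Fin n))) (xs : EuclideanSpace ℝ (Fin n)) : Prop :=
  xs ∈ ⋂ i, X i ∧ ∀ y ∈ ⋂ i, X i, objective f xs ≤ objective f y

/-- Standing assumptions on the optimisation problem. -/
structure ProblemAssumptions {n m : ℕ} (f : Fin m → EuclideanSpace ℝ (Fin n) → ℝ)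
    (X : Fin m → Set (EuclideanSpace ℝ (Fin n))) : Prop where
  convex_objective : ∀ i, ConvexOn ℝ Set.univ (f i)
  compact_set : ∀ i, IsCompact (X i)
  convex_set : ∀ i, Convex ℝ (X i)
  interior_nonempty : (interior (⋂ i, X i)).Nonempty
  bounded_subgradient :
    ∃ L : ℝ, ∀ x ∈ ⋃ i, X i, ∀ ξ ∈ subdifferential (objective f) x, ‖ξ‖ ≤ L

/-- Agent `j` sends information to agent `i` at time `k`, i.e. `(j, i)` is an edge of the
communication graph at time `k`. The weight `A k j i` is the entry in row `j` and column `i`,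
the one agent `i` gives to the information received from agent `j`. -/
def Communicates {m : ℕ} (A : ℕ → Matrix (Fin m) (Fin m) ℝ) (k : ℕ) (j i : Fin m) : Prop :=
  0 < A k j i

/-- Edges of the limit graph: agent `j` communicates with agent `i` infinitely often. -/
def LimitEdge {m : ℕ} (A : ℕ → Matrix (Fin m) (Fin m) ℝ) (j i : Fin m) : Prop :=
  ∃ᶠ k in atTop, Communicates A k j i

/-- Standing assumptions on the time-varying network and its weights. -/
structure NetworkAssumptions {m : ℕ} (A : ℕ → Matrix (Fin m) (Fin m) ℝ) : Prop where
  /-- The limit graph is strongly connected: a directed path leads from any agent to any other. -/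
  strongly_connected : ∀ j i, Relation.ReflTransGen (LimitEdge A) j i
  /-- Uniform bound `T` on the communication time: every edge of the limit graph is active at
  least once in any `T` consecutive iterations. -/
  bounded_communication : ∃ T : ℕ, ∀ j i, LimitEdge A j i →
    ∀ k, ∃ l, k ≤ l ∧ l < k + T ∧ Communicates A l j i
  weights_bounded_below : ∃ η : ℝ, 0 < η ∧ η < 1 ∧ ∀ k,
    (∀ i, η ≤ A k i i) ∧ ∀ j i, 0 < A k j i → η ≤ A k j i
  doubly_stochastic : ∀ k, A k ∈ doublyStochastic ℝ (Fin m)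

/-- Standing assumptions on the step sizes. -/
structure StepSizeAssumptions (c : ℕ → ℝ) : Prop where
  nonneg : ∀ k, 0 ≤ c k
  nonincreasing : Antitone c
  not_summable : ¬ Summable c
  square_summable : Summable fun k => c k ^ 2

/-- `x`, `z`, `g`, `d` are sequences generated by the subgradient-averaging algorithm: `x k i` is
the iterate of agent `i` at time `k`, `z k i` its average, `g k i` the subgradient of `f i` it
picks at `z k i`, and `d k i` the averaged subgradient. -/
structure IsRun {n m : ℕ} (f : Fin m → EuclideanSpace ℝ (Fin n) → ℝ)
    (X : Fin m → Set (EuclideanSpace ℝ (Fin n))) (A : ℕ → Matrix (Fin m) (Fin m) ℝ)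
    (c : ℕ → ℝ) (x z g d : ℕ → Fin m → EuclideanSpace ℝ (Fin n)) : Prop where
  init : ∀ i, x 0 i ∈ X i
  average : ∀ k i, z k i = ∑ j, A k j i • x k j
  subgradient : ∀ k i, g k i ∈ subdifferential (f i) (z k i)
  average_subgradient : ∀ k i, d k i = ∑ j, A k j i • g k j
  update_mem : ∀ k i, x (k + 1) i ∈ X i
  /-- `x (k + 1) i` minimises `ξ ↦ ⟨d k i, ξ⟩ + ‖z k i - ξ‖² / (2 c k)` over `X i`. -/
  update_min : ∀ k i, ∀ ξ ∈ X i,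
    inner ℝ (d k i) (x (k + 1) i) + 1 / (2 * c k) * ‖z k i - x (k + 1) i‖ ^ 2 ≤
      inner ℝ (d k i) ξ + 1 / (2 * c k) * ‖z k i - ξ‖ ^ 2

end SubgradAvg

/-! A proximal step is a metric projection, and its three-point inequality says that
`∑ i, ‖x k i - y‖²` drops by `2 c k` times the objective gap and by the square of the move
`x (k + 1) - average (A k) (x k)`, up to an error `c k · (diam + move)`, where `diam` is the
diameter of the set of iterates at time `k + 1`. By connectivity the products of the averaging
matrices over long windows have entries bounded below, so averaging contracts the diameter and
`∑ diam² ≤ M (1 + ∑ move²)`. Young's inequality therefore absorbs the error into the `move²` already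
gained, at the price of a multiple of `∑ (c k)² < ∞`. Consequently `∑ diam²` and `∑ c k · gap` are
finite and `∑ i, ‖x k i - y‖²` converges, for every minimiser `y`. Since `∑ c k = ∞`, the gap is
arbitrarily small infinitely often, so the iterates have a common cluster point that is a minimiser;
taking `y` to be that point, the limit of `∑ i, ‖x k i - y‖²` is zero.

The gap is evaluated at a feasible point within a multiple of `diam` of all iterates, which exists
because the intersection of the constraint sets contains a ball. -/

namespace SubgradAvg

open Matrix Metric
open scoped NNReal

section Average

variable {ι V : Type*} [NormedAddCommGroup V]

lemma norm_sub_le_diam_range [Finite ι] (y : ι → V) (i j : ι) :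
    ‖y i - y j‖ ≤ diam (Set.range y) := by
  rw [← dist_eq_norm]
  exact dist_le_diam_of_mem (Set.finite_range y).isBounded (Set.mem_range_self i)
    (Set.mem_range_self j)

lemma diam_range_le {y : ι → V} {r : ℝ} (hr : 0 ≤ r) (h : ∀ i j, ‖y i - y j‖ ≤ r) :
    diam (Set.range y) ≤ r := by
  refine diam_le_of_forall_dist_le hr ?_
  rintro _ ⟨i, rfl⟩ _ ⟨j, rfl⟩
  exact (dist_eq_norm _ _).trans_le (h i j)

variable [Fintype ι]

lemma diam_range_le_add_norm_sub (y w : ι → V) :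
    diam (Set.range y) ≤ diam (Set.range w) + 2 * ‖y - w‖ := by
  refine diam_range_le (by positivity) fun i j => ?_
  calc ‖y i - y j‖ = ‖(w i - w j) + ((y - w) i - (y - w) j)‖ := by
        congr 1; simp only [Pi.sub_apply]; abel
    _ ≤ ‖w i - w j‖ + (‖(y - w) i‖ + ‖(y - w) j‖) :=
        (norm_add_le _ _).trans (by gcongr; exact norm_sub_le _ _)
    _ ≤ diam (Set.range w) + 2 * ‖y - w‖ := by
        linarith [norm_sub_le_diam_range w i j, norm_le_pi_norm (y - w) i,
          norm_le_pi_norm (y - w) j]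

variable [NormedSpace ℝ V]

/-- The action of a matrix on families of vectors by weighted averages `i ↦ ∑ j, B j i • y j`. The
weights of the `i`-th average form the `i`-th column of `B`, so these are averages in the proper
sense when `B` is column stochastic. -/
def average (B : Matrix ι ι ℝ) : (ι → V) →ₗ[ℝ] (ι → V) :=
  LinearMap.pi fun i => ∑ j, B j i • LinearMap.proj j

lemma average_apply (B : Matrix ι ι ℝ) (y : ι → V) (i : ι) :
    average B y i = ∑ j, B j i • y j := by
  simp [average]

lemma average_mul (B C : Matrix ι ι ℝ) (y : ι → V) :
    average (B * C) y = average C (average B y) := by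
  ext i
  simp only [average_apply, Matrix.mul_apply, Finset.sum_smul, Finset.smul_sum, smul_smul]
  rw [Finset.sum_comm]
  simp only [mul_comm]

variable [DecidableEq ι]

lemma average_one (y : ι → V) : average (1 : Matrix ι ι ℝ) y = y := by
  ext i
  simp [average_apply, Matrix.one_apply]

lemma sum_average {B : Matrix ι ι ℝ} (hB : B ∈ rowStochastic ℝ ι) (y : ι → V) :
    ∑ i, average B y i = ∑ j, y j := by
  simp only [average_apply]
  rw [Finset.sum_comm]
  simp only [← Finset.sum_smul, sum_row_of_mem_rowStochastic hB, one_smul]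

section ColStochastic

variable {B : Matrix ι ι ℝ} (hB : B ∈ colStochastic ℝ ι) (y : ι → V)
include hB

lemma average_sub_const (a : V) (i : ι) : average B y i - a = ∑ j, B j i • (y j - a) := by
  simp only [average_apply, smul_sub, Finset.sum_sub_distrib, ← Finset.sum_smul,
    sum_col_of_mem_colStochastic hB, one_smul]

lemma average_mem_convexHull (i : ι) : average B y i ∈ convexHull ℝ (Set.range y) := by
  rw [average_apply]
  exact (convex_convexHull ℝ _).sum_mem (fun _ _ => nonneg_of_mem_colStochastic hB)
    (sum_col_of_mem_colStochastic hB i) fun j _ => subset_convexHull ℝ _ (Set.mem_range_self j)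

lemma norm_average_le : ‖average B y‖ ≤ ‖y‖ := by
  refine (pi_norm_le_iff_of_nonneg (norm_nonneg _)).2 fun i => ?_
  have hball : Set.range y ⊆ closedBall 0 ‖y‖ := by
    rintro _ ⟨j, rfl⟩
    exact mem_closedBall_zero_iff.2 (norm_le_pi_norm y j)
  exact mem_closedBall_zero_iff.1
    (convexHull_min hball (convex_closedBall 0 _) (average_mem_convexHull hB y i))

lemma average_sub_average (i i' : ι) :
    average B y i - average B y i' = ∑ l, ∑ l', (B l i * B l' i') • (y l - y l') := by
  rw [average_sub_const hB]
  refine Finset.sum_congr rfl fun l _ => ?_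
  rw [← neg_sub, average_sub_const hB, ← Finset.sum_neg_distrib, Finset.smul_sum]
  refine Finset.sum_congr rfl fun l' _ => ?_
  rw [← smul_neg, neg_sub, smul_smul]

-- Draw `l` and `l'` independently from the columns `i` and `i'`: they coincide with probability at
-- least `δ`, and then `y l - y l'` does not contribute to the difference of the two averages.
lemma diam_range_average_le {δ : ℝ} (hδ : ∀ j i, δ ≤ B j i) :
    diam (Set.range (average B y)) ≤ (1 - δ) * diam (Set.range y) := by
  have h0 : ∀ j i, 0 ≤ B j i := fun _ _ => nonneg_of_mem_colStochastic hB
  have hcol : ∀ i, ∑ j, B j i = 1 := sum_col_of_mem_colStochastic hB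
  rcases isEmpty_or_nonempty ι with hι | ⟨⟨i₀⟩⟩
  · simp only [Set.range_eq_empty, diam_empty, mul_zero, le_refl]
  have hδ1 : δ ≤ 1 := (hδ i₀ i₀).trans (le_one_of_mem_colStochastic hB)
  refine diam_range_le (mul_nonneg (sub_nonneg.2 hδ1) diam_nonneg) fun i i' => ?_
  have hcoincide : δ ≤ ∑ l, B l i * B l i' :=
    calc δ = ∑ l, B l i * δ := by rw [← Finset.sum_mul, hcol, one_mul]
      _ ≤ ∑ l, B l i * B l i' :=
        Finset.sum_le_sum fun l _ => mul_le_mul_of_nonneg_left (hδ _ _) (h0 _ _)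
  have hterm : ∀ l l', ‖(B l i * B l' i') • (y l - y l')‖ ≤
      (B l i * B l' i' - if l = l' then B l i * B l i' else 0) * diam (Set.range y) := by
    intro l l'
    split_ifs with h
    · subst h
      simp
    · rw [norm_smul, Real.norm_of_nonneg (mul_nonneg (h0 _ _) (h0 _ _)), sub_zero]
      exact mul_le_mul_of_nonneg_left (norm_sub_le_diam_range y l l')
        (mul_nonneg (h0 _ _) (h0 _ _))
  calc ‖average B y i - average B y i'‖
      ≤ ∑ l, ∑ l', (B l i * B l' i' - if l = l' then B l i * B l i' else 0) *
          diam (Set.range y) := by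
        rw [average_sub_average hB]
        exact norm_sum_le_of_le _ fun l _ => norm_sum_le_of_le _ fun l' _ => hterm l l'
    _ = (1 - ∑ l, B l i * B l i') * diam (Set.range y) := by
        simp only [← Finset.sum_mul, Finset.sum_sub_distrib, ← Finset.mul_sum, hcol,
          Finset.sum_ite_eq, Finset.mem_univ, if_true, mul_one]
    _ ≤ (1 - δ) * diam (Set.range y) := by gcongr

end ColStochastic

lemma sum_norm_average_sub_sq_le {B : Matrix ι ι ℝ} (hB : B ∈ doublyStochastic ℝ ι) (y : ι → V)
    (a : V) : ∑ i, ‖average B y i - a‖ ^ 2 ≤ ∑ j, ‖y j - a‖ ^ 2 := by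
  obtain ⟨hrow, hcol⟩ := mem_doublyStochastic_iff_mem_rowStochastic_and_mem_colStochastic.1 hB
  have hconv : ConvexOn ℝ Set.univ fun v : V => ‖v‖ ^ 2 :=
    convexOn_univ_norm.pow (fun _ _ => norm_nonneg _) 2
  calc ∑ i, ‖average B y i - a‖ ^ 2 ≤ ∑ i, ∑ j, B j i * ‖y j - a‖ ^ 2 := by
        refine Finset.sum_le_sum fun i _ => ?_
        rw [average_sub_const hcol]
        exact hconv.map_sum_le (fun _ _ => nonneg_of_mem_colStochastic hcol)
          (sum_col_of_mem_colStochastic hcol i) fun _ _ => Set.mem_univ _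
    _ = ∑ j, ‖y j - a‖ ^ 2 := by
        rw [Finset.sum_comm]
        simp only [← Finset.sum_mul, sum_row_of_mem_rowStochastic hrow, one_mul]

end Average

section Transition

variable {ι : Type*} [Fintype ι] [DecidableEq ι] {A : ℕ → Matrix ι ι ℝ}

/-- The matrix `A k * A (k + 1) * ⋯ * A (k + s - 1)` taking the state at time `k` to the state at
time `k + s` in the unperturbed averaging process. -/
def transition (A : ℕ → Matrix ι ι ℝ) (k : ℕ) : ℕ → Matrix ι ι ℝ
  | 0 => 1
  | s + 1 => transition A k s * A (k + s)

lemma transition_mem {M : Submonoid (Matrix ι ι ℝ)} (hA : ∀ k, A k ∈ M) (k s : ℕ) :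
    transition A k s ∈ M := by
  induction s with
  | zero => exact one_mem M
  | succ s ih => exact mul_mem ih (hA _)

lemma transition_nonneg (hA : ∀ k j i, 0 ≤ A k j i) (k s : ℕ) (j i : ι) :
    0 ≤ transition A k s j i := by
  induction s generalizing i with
  | zero =>
    rw [transition, Matrix.one_apply]
    split_ifs <;> norm_num
  | succ s ih =>
    rw [transition, Matrix.mul_apply]
    exact Finset.sum_nonneg fun l _ => mul_nonneg (ih l) (hA _ l i)

lemma pow_le_transition_succ (hA : ∀ k j i, 0 ≤ A k j i) {η : ℝ} (hη : 0 ≤ η) {k s : ℕ}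
    {j i l : ι} (hji : η ^ s ≤ transition A k s j i) (hil : η ≤ A (k + s) i l) :
    η ^ (s + 1) ≤ transition A k (s + 1) j l :=
  calc η ^ (s + 1) = η ^ s * η := pow_succ _ _
    _ ≤ transition A k s j i * A (k + s) i l :=
        mul_le_mul hji hil hη (transition_nonneg hA k s j i)
    _ ≤ ∑ i, transition A k s j i * A (k + s) i l :=
        Finset.single_le_sum (f := fun i => transition A k s j i * A (k + s) i l)
          (fun i _ => mul_nonneg (transition_nonneg hA k s j i) (hA _ i l)) (Finset.mem_univ i)

lemma pow_le_transition_of_le (hA : ∀ k j i, 0 ≤ A k j i) {η : ℝ} (hη : 0 ≤ η)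
    (hdiag : ∀ k i, η ≤ A k i i) {k s t : ℕ} {j i : ι} (h : η ^ s ≤ transition A k s j i)
    (hst : s ≤ t) : η ^ t ≤ transition A k t j i := by
  induction t, hst using Nat.le_induction with
  | base => exact h
  | succ t _ ih => exact pow_le_transition_succ hA hη ih (hdiag _ _)

/-- Joint connectivity of a sequence of averaging matrices, uniformly over time windows: some weight
`η > 0` bounds the diagonal entries from below, and the pairs `(j, i)` with `η ≤ A l j i` for some
`l` in every window `[k, k + T)` form a strongly connected graph. -/
def UniformlyConnected (A : ℕ → Matrix ι ι ℝ) : Prop :=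
  ∃ η > 0, ∃ T, (∀ k i, η ≤ A k i i) ∧
    ∀ j i, Relation.ReflTransGen (fun j i => ∀ k, ∃ l ∈ Set.Ico k (k + T), η ≤ A l j i) j i

lemma UniformlyConnected.exists_le_transition (hconn : UniformlyConnected A)
    (hA : ∀ k j i, 0 ≤ A k j i) : ∃ W, ∃ δ > 0, ∀ k j i, δ ≤ transition A k W j i := by
  obtain ⟨η, hη, T, hdiag, hpath⟩ := hconn
  have hpair : ∀ j i, ∃ S, ∀ k, η ^ S ≤ transition A k S j i := by
    intro j i
    induction hpath j i with
    | refl => exact ⟨0, fun k => by rw [pow_zero, transition, Matrix.one_apply_eq]⟩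
    | @tail i l _ hil ih =>
      obtain ⟨S, hS⟩ := ih
      refine ⟨S + T, fun k => ?_⟩
      obtain ⟨t, ⟨hkt, htT⟩, ht⟩ := hil (k + S)
      obtain ⟨r, rfl⟩ := Nat.exists_eq_add_of_le (show k ≤ t by omega)
      have hbefore : η ^ r ≤ transition A k r j i :=
        pow_le_transition_of_le hA hη.le hdiag (hS k) (by omega)
      have hafter := pow_le_transition_succ hA hη.le hbefore ht
      exact pow_le_transition_of_le hA hη.le hdiag hafter (by omega)
  choose S hS using hpair
  obtain ⟨W, hW⟩ := Finite.bddAbove_range fun p : ι × ι => S p.1 p.2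
  exact ⟨W, η ^ W, pow_pos hη W, fun k j i =>
    pow_le_transition_of_le hA hη.le hdiag (hS j i k) (hW ⟨(j, i), rfl⟩)⟩

end Transition

section Consensus

lemma mul_sum_range_le_of_le_add {a β : ℕ → ℝ} {δ : ℝ} {W : ℕ} (ha : ∀ k, 0 ≤ a k) (hδ : δ ≤ 1)
    (h : ∀ k, a (k + W) ≤ (1 - δ) * a k + β k) (N : ℕ) :
    δ * ∑ k ∈ Finset.range N, a k ≤
      ∑ k ∈ Finset.range W, a k + ∑ k ∈ Finset.range (N - W), β k := by
  have hmono : ∀ {p q : ℕ}, p ≤ q → ∑ k ∈ Finset.range p, a k ≤ ∑ k ∈ Finset.range q, a k :=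
    fun hpq => Finset.sum_le_sum_of_subset_of_nonneg (Finset.range_mono hpq) fun k _ _ => ha k
  rcases le_total N W with hN | hN
  · rw [Nat.sub_eq_zero_of_le hN, Finset.sum_range_zero, add_zero]
    exact (mul_le_of_le_one_left (Finset.sum_nonneg fun k _ => ha k) hδ).trans (hmono hN)
  · obtain ⟨M, rfl⟩ := Nat.exists_eq_add_of_le hN
    rw [Nat.add_sub_cancel_left]
    have hsplit : ∑ k ∈ Finset.range (W + M), a k =
        ∑ k ∈ Finset.range W, a k + ∑ k ∈ Finset.range M, a (k + W) := by
      rw [Finset.sum_range_add]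
      simp only [add_comm W]
    have hshift : ∑ k ∈ Finset.range M, a (k + W) ≤
        (1 - δ) * ∑ k ∈ Finset.range (W + M), a k + ∑ k ∈ Finset.range M, β k :=
      calc ∑ k ∈ Finset.range M, a (k + W)
          ≤ ∑ k ∈ Finset.range M, ((1 - δ) * a k + β k) := Finset.sum_le_sum fun k _ => h k
        _ = (1 - δ) * ∑ k ∈ Finset.range M, a k + ∑ k ∈ Finset.range M, β k := by
          rw [Finset.sum_add_distrib, Finset.mul_sum]
        _ ≤ (1 - δ) * ∑ k ∈ Finset.range (W + M), a k + ∑ k ∈ Finset.range M, β k :=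
          add_le_add_left (mul_le_mul_of_nonneg_left (hmono (Nat.le_add_left M W))
            (sub_nonneg.2 hδ)) _
    linarith

lemma sum_window_le_mul_sum {b : ℕ → ℝ} (hb : ∀ k, 0 ≤ b k) (W N : ℕ) :
    ∑ k ∈ Finset.range (N + 1 - W), ∑ r ∈ Finset.range W, b (k + r) ≤
      W * ∑ k ∈ Finset.range N, b k := by
  have hshift : ∀ r ∈ Finset.range W,
      ∑ k ∈ Finset.range (N + 1 - W), b (k + r) ≤ ∑ k ∈ Finset.range N, b k := by
    intro r hr
    rw [Finset.range_eq_Ico, Finset.sum_Ico_add']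
    refine Finset.sum_le_sum_of_subset_of_nonneg (fun j hj => ?_) fun k _ _ => hb k
    simp only [Finset.mem_Ico, Finset.mem_range] at hj hr ⊢
    omega
  rw [Finset.sum_comm]
  simpa only [Finset.card_range, nsmul_eq_mul] using Finset.sum_le_card_nsmul _ _ _ hshift

lemma mul_sum_range_succ_le_of_window {a b : ℕ → ℝ} {δ C : ℝ} {W : ℕ} (ha : ∀ k, 0 ≤ a k)
    (hb : ∀ k, 0 ≤ b k) (hδ : δ ≤ 1) (hC : 0 ≤ C)
    (h : ∀ k, a (k + W) ≤ (1 - δ) * a k + C * ∑ r ∈ Finset.range W, b (k + r)) (N : ℕ) :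
    δ * ∑ k ∈ Finset.range (N + 1), a k ≤
      ∑ k ∈ Finset.range W, a k + C * W * ∑ k ∈ Finset.range N, b k := by
  have hsum := mul_sum_range_le_of_le_add ha hδ h (N + 1)
  rw [← Finset.mul_sum] at hsum
  rw [mul_assoc]
  exact hsum.trans (by gcongr; exact sum_window_le_mul_sum hb W N)

-- Jensen for the square, with `s` and `2 * w / δ` taken with the weights `1 - δ` and `δ`.
lemma sq_one_sub_mul_add_le {δ s w : ℝ} (hδ : 0 < δ) (hδ1 : δ ≤ 1) :
    ((1 - δ) * s + 2 * w) ^ 2 ≤ (1 - δ) * s ^ 2 + 4 / δ * w ^ 2 := by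
  have hgap : (1 - δ) * s ^ 2 + 4 / δ * w ^ 2 - ((1 - δ) * s + 2 * w) ^ 2 =
      (1 - δ) * δ * (s - 2 * w / δ) ^ 2 := by
    field_simp
    ring
  have hgap_nonneg : 0 ≤ (1 - δ) * δ * (s - 2 * w / δ) ^ 2 :=
    mul_nonneg (mul_nonneg (sub_nonneg.2 hδ1) hδ.le) (sq_nonneg _)
  linarith

variable {ι V : Type*} [Fintype ι] [DecidableEq ι] [NormedAddCommGroup V] [NormedSpace ℝ V]
  {A : ℕ → Matrix ι ι ℝ} (hA : ∀ k, A k ∈ colStochastic ℝ ι) (x : ℕ → ι → V)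
include hA

lemma norm_sub_average_transition_le (k s : ℕ) :
    ‖x (k + s) - average (transition A k s) (x k)‖ ≤
      ∑ r ∈ Finset.range s, ‖x (k + r + 1) - average (A (k + r)) (x (k + r))‖ := by
  induction s with
  | zero => simp only [transition, average_one, add_zero, sub_self, norm_zero, Finset.range_zero,
      Finset.sum_empty, le_refl]
  | succ s ih =>
    have hsplit : x (k + (s + 1)) - average (transition A k (s + 1)) (x k) =
        average (A (k + s)) (x (k + s) - average (transition A k s) (x k)) +
          (x (k + s + 1) - average (A (k + s)) (x (k + s))) := by
      rw [transition, average_mul, map_sub, add_assoc]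
      abel
    rw [hsplit, Finset.sum_range_succ]
    exact (norm_add_le _ _).trans (by gcongr; exact (norm_average_le (hA _) _).trans ih)

lemma diam_sq_le_of_le_transition {W : ℕ} {δ : ℝ} (hδ : 0 < δ) (hδ1 : δ ≤ 1) {k : ℕ}
    (h : ∀ j i, δ ≤ transition A k W j i) :
    diam (Set.range (x (k + W))) ^ 2 ≤ (1 - δ) * diam (Set.range (x k)) ^ 2 +
      4 / δ * W * ∑ r ∈ Finset.range W, ‖x (k + r + 1) - average (A (k + r)) (x (k + r))‖ ^ 2 := by
  set e := fun r => ‖x (k + r + 1) - average (A (k + r)) (x (k + r))‖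
  have hcontract : diam (Set.range (x (k + W))) ≤
      (1 - δ) * diam (Set.range (x k)) + 2 * ∑ r ∈ Finset.range W, e r := by
    have hmix := diam_range_average_le (transition_mem hA k W) (x k) h
    have hdrift := norm_sub_average_transition_le hA x k W
    have hpert := diam_range_le_add_norm_sub (x (k + W)) (average (transition A k W) (x k))
    linarith
  have hcauchy : (∑ r ∈ Finset.range W, e r) ^ 2 ≤ W * ∑ r ∈ Finset.range W, e r ^ 2 := by
    simpa only [Finset.card_range] using sq_sum_le_card_mul_sum_sq (s := Finset.range W) (f := e)
  calc diam (Set.range (x (k + W))) ^ 2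
      ≤ ((1 - δ) * diam (Set.range (x k)) + 2 * ∑ r ∈ Finset.range W, e r) ^ 2 :=
        pow_le_pow_left₀ diam_nonneg hcontract 2
    _ ≤ (1 - δ) * diam (Set.range (x k)) ^ 2 + 4 / δ * (∑ r ∈ Finset.range W, e r) ^ 2 :=
        sq_one_sub_mul_add_le hδ hδ1
    _ ≤ _ := by
        rw [mul_assoc (4 / δ)]
        gcongr

lemma UniformlyConnected.exists_sum_diam_sq_le [Nonempty ι] (hconn : UniformlyConnected A) :
    ∃ M, 0 ≤ M ∧ ∀ N, ∑ k ∈ Finset.range (N + 1), diam (Set.range (x k)) ^ 2 ≤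
      M * (1 + ∑ k ∈ Finset.range N, ‖x (k + 1) - average (A k) (x k)‖ ^ 2) := by
  obtain ⟨W, δ, hδ, htrans⟩ :=
    hconn.exists_le_transition fun k j i => nonneg_of_mem_colStochastic (hA k)
  obtain ⟨i₀⟩ := ‹Nonempty ι›
  have hδ1 : δ ≤ 1 :=
    (htrans 0 i₀ i₀).trans (le_one_of_mem_colStochastic (transition_mem hA 0 W))
  set a₀ := ∑ k ∈ Finset.range W, diam (Set.range (x k)) ^ 2
  have ha₀ : 0 ≤ a₀ := Finset.sum_nonneg fun k _ => sq_nonneg _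
  have hC : 0 ≤ 4 / δ * W := by positivity
  refine ⟨(a₀ + 4 / δ * W * W) / δ, by positivity, fun N => ?_⟩
  have hwindow := mul_sum_range_succ_le_of_window (a := fun k => diam (Set.range (x k)) ^ 2)
    (b := fun k => ‖x (k + 1) - average (A k) (x k)‖ ^ 2) (fun k => sq_nonneg _)
    (fun k => sq_nonneg _) hδ1 hC
    (fun k => diam_sq_le_of_le_transition hA x hδ hδ1 (htrans k)) N
  have hb : 0 ≤ ∑ k ∈ Finset.range N, ‖x (k + 1) - average (A k) (x k)‖ ^ 2 :=
    Finset.sum_nonneg fun k _ => sq_nonneg _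
  rw [div_mul_eq_mul_div, le_div_iff₀' hδ]
  have hW : 0 ≤ 4 / δ * W * W := by positivity
  linarith [mul_nonneg ha₀ hb]

end Consensus

section Sequences

lemma exists_tendsto_of_le_add_summable {u β : ℕ → ℝ} (hu : ∀ k, 0 ≤ u k) (hβ : ∀ k, 0 ≤ β k)
    (hsum : Summable β) (h : ∀ k, u (k + 1) ≤ u k + β k) : ∃ l, Tendsto u atTop (𝓝 l) := by
  have hanti : Antitone fun k => u k - ∑ r ∈ Finset.range k, β r :=
    antitone_nat_of_succ_le fun k => by
      rw [Finset.sum_range_succ]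
      linarith [h k]
  have hbdd : BddBelow (Set.range fun k => u k - ∑ r ∈ Finset.range k, β r) := by
    refine ⟨-∑' r, β r, ?_⟩
    rintro _ ⟨k, rfl⟩
    have hpartial := hsum.sum_le_tsum (Finset.range k) fun r _ => hβ r
    linarith [hu k]
  have hlim := (tendsto_atTop_ciInf hanti hbdd).add hsum.hasSum.tendsto_sum_nat
  exact ⟨_, hlim.congr fun k => sub_add_cancel _ _⟩

lemma frequently_lt_of_summable_mul {c Δ : ℕ → ℝ} (hc : ∀ k, 0 ≤ c k) (hcs : ¬ Summable c)
    (h : Summable fun k => c k * Δ k) {ε : ℝ} (hε : 0 < ε) : ∃ᶠ k in atTop, Δ k < ε := by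
  intro hev
  refine hcs (Summable.of_norm_bounded_eventually_nat (h.mul_left ε⁻¹) ?_)
  filter_upwards [hev] with k hk
  rw [Real.norm_of_nonneg (hc k), inv_mul_eq_div, le_div_iff₀ hε]
  exact mul_le_mul_of_nonneg_left (not_lt.1 hk) (hc k)

variable {u a b w γ : ℕ → ℝ} {M : ℝ}

lemma add_sum_range_le_of_descent (ha : 0 ≤ a 0) (hM : 0 ≤ M)
    (hdesc : ∀ k, u (k + 1) + b k + w k ≤
      u k + (2 * (M + 1))⁻¹ * (a (k + 1) + b k) + γ k)
    (hsum : ∀ N, ∑ k ∈ Finset.range (N + 1), a k ≤ M * (1 + ∑ k ∈ Finset.range N, b k)) (N : ℕ) :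
    u N + 1 / 2 * ∑ k ∈ Finset.range N, b k + ∑ k ∈ Finset.range N, w k ≤
      u 0 + 1 / 2 + ∑ k ∈ Finset.range N, γ k := by
  have htelescope : u N + ∑ k ∈ Finset.range N, b k + ∑ k ∈ Finset.range N, w k ≤
      u 0 + (2 * (M + 1))⁻¹ * (∑ k ∈ Finset.range N, a (k + 1) + ∑ k ∈ Finset.range N, b k) +
        ∑ k ∈ Finset.range N, γ k := by
    induction N with
    | zero => simp only [Finset.range_zero, Finset.sum_empty, add_zero, mul_zero, le_refl]
    | succ N ih =>
      simp only [Finset.sum_range_succ]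
      linarith [hdesc N]
  have habsorb : (2 * (M + 1))⁻¹ *
      (∑ k ∈ Finset.range N, a (k + 1) + ∑ k ∈ Finset.range N, b k) ≤
        1 / 2 * (1 + ∑ k ∈ Finset.range N, b k) := by
    have hshift := hsum N
    rw [Finset.sum_range_succ'] at hshift
    rw [inv_mul_le_iff₀ (by positivity)]
    linarith
  linarith

lemma summable_and_summable_of_descent (hu : ∀ k, 0 ≤ u k) (ha : 0 ≤ a 0) (hb : ∀ k, 0 ≤ b k)
    (hw : ∀ k, 0 ≤ w k) (hγ : ∀ k, 0 ≤ γ k) (hγs : Summable γ) (hM : 0 ≤ M)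
    (hdesc : ∀ k, u (k + 1) + b k + w k ≤
      u k + (2 * (M + 1))⁻¹ * (a (k + 1) + b k) + γ k)
    (hsum : ∀ N, ∑ k ∈ Finset.range (N + 1), a k ≤ M * (1 + ∑ k ∈ Finset.range N, b k)) :
    Summable b ∧ Summable w := by
  have hbound := fun N => (add_sum_range_le_of_descent ha hM hdesc hsum N).trans
    (add_le_add_right (hγs.sum_le_tsum _ fun k _ => hγ k) _)
  have hbN : ∀ N, 0 ≤ ∑ k ∈ Finset.range N, b k := fun N => Finset.sum_nonneg fun k _ => hb k
  have hwN : ∀ N, 0 ≤ ∑ k ∈ Finset.range N, w k := fun N => Finset.sum_nonneg fun k _ => hw k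
  refine ⟨summable_of_sum_range_le (c := 2 * (u 0 + 1 / 2 + ∑' k, γ k)) hb fun N => ?_,
    summable_of_sum_range_le (c := u 0 + 1 / 2 + ∑' k, γ k) hw fun N => ?_⟩ <;>
  linarith [hbound N, hu N, hbN N, hwN N]

lemma summable_of_sum_range_succ_le (ha : ∀ k, 0 ≤ a k) (hb : ∀ k, 0 ≤ b k) (hbs : Summable b)
    (hM : 0 ≤ M)
    (hsum : ∀ N, ∑ k ∈ Finset.range (N + 1), a k ≤ M * (1 + ∑ k ∈ Finset.range N, b k)) :
    Summable a := by
  refine summable_of_sum_range_le (c := M * (1 + ∑' k, b k)) ha fun N => ?_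
  calc ∑ k ∈ Finset.range N, a k ≤ ∑ k ∈ Finset.range (N + 1), a k := by
        rw [Finset.sum_range_succ]
        exact le_add_of_nonneg_right (ha N)
    _ ≤ M * (1 + ∑ k ∈ Finset.range N, b k) := hsum N
    _ ≤ M * (1 + ∑' k, b k) := by
        gcongr
        exact hbs.sum_le_tsum _ fun k _ => hb k

lemma tendsto_and_summable_of_descent (hu : ∀ k, 0 ≤ u k) (ha : ∀ k, 0 ≤ a k) (hb : ∀ k, 0 ≤ b k)
    (hw : ∀ k, 0 ≤ w k) (hγ : ∀ k, 0 ≤ γ k) (hγs : Summable γ) (hM : 0 ≤ M)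
    (hdesc : ∀ k, u (k + 1) + b k + w k ≤
      u k + (2 * (M + 1))⁻¹ * (a (k + 1) + b k) + γ k)
    (hsum : ∀ N, ∑ k ∈ Finset.range (N + 1), a k ≤ M * (1 + ∑ k ∈ Finset.range N, b k)) :
    Summable a ∧ Summable w ∧ ∃ l, Tendsto u atTop (𝓝 l) := by
  obtain ⟨hbs, hws⟩ := summable_and_summable_of_descent hu (ha 0) hb hw hγ hγs hM hdesc hsum
  have has := summable_of_sum_range_succ_le ha hb hbs hM hsum
  refine ⟨has, hws, exists_tendsto_of_le_add_summable hu (fun k => ?_)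
    ((((summable_nat_add_iff 1).2 has).add hbs).mul_left (2 * (M + 1))⁻¹ |>.add hγs)
    fun k => ?_⟩
  · have := ha (k + 1)
    have := hb k
    have := hγ k
    positivity
  · linarith [hdesc k, hb k, hw k]

lemma mul_add_le_mul_add_sq {θ : ℝ} (hθ : 0 < θ) (q s e : ℝ) :
    q * (s + e) ≤ θ * (s ^ 2 + e ^ 2) + (2 * θ)⁻¹ * q ^ 2 := by
  have hs := two_mul_le_add_mul_sq (a := s) (b := q) (ε := 2 * θ) (by positivity)
  have he := two_mul_le_add_mul_sq (a := e) (b := q) (ε := 2 * θ) (by positivity)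
  linarith

end Sequences

section Proximal

variable {V : Type*} [NormedAddCommGroup V] [InnerProductSpace ℝ V] {X : Set V} {c : ℝ}
  {d z p y : V}

/-- The objective of the proximal step from `z` along `d` with step size `c`. At `c = 0` the
quadratic term vanishes, since `1 / 0 = 0`. -/
noncomputable def proxObjective (c : ℝ) (d z ξ : V) : ℝ :=
  inner ℝ d ξ + 1 / (2 * c) * ‖z - ξ‖ ^ 2

lemma two_mul_proxObjective (hc : 0 < c) (d z ξ : V) :
    2 * c * proxObjective c d z ξ =
      ‖z - c • d - ξ‖ ^ 2 + (2 * c * inner ℝ d z - c ^ 2 * ‖d‖ ^ 2) := by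
  have hexpand : ‖z - c • d - ξ‖ ^ 2 =
      ‖z - ξ‖ ^ 2 - 2 * c * (inner ℝ d z - inner ℝ d ξ) + c ^ 2 * ‖d‖ ^ 2 := by
    rw [sub_right_comm, norm_sub_sq_real, real_inner_smul_right, real_inner_comm, inner_sub_right,
      norm_smul, mul_pow, Real.norm_of_nonneg hc.le]
    ring
  rw [hexpand, proxObjective]
  field_simp
  ring

-- Completing the square, the proximal step is the metric projection of `z - c • d` onto `X`.
lemma inner_le_zero_of_isMinOn_proxObjective (hX : Convex ℝ X) (hc : 0 < c) (hp : p ∈ X)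
    (hmin : IsMinOn (proxObjective c d z) X p) (hy : y ∈ X) :
    inner ℝ (z - c • d - p) (y - p) ≤ 0 := by
  have hproj : IsMinOn (fun ξ => ‖z - c • d - ξ‖) X p := by
    refine isMinOn_iff.2 fun ξ hξ => ?_
    have hle := mul_le_mul_of_nonneg_left (isMinOn_iff.1 hmin ξ hξ)
      (by positivity : 0 ≤ 2 * c)
    rw [two_mul_proxObjective hc, two_mul_proxObjective hc, add_le_add_iff_right] at hle
    exact le_of_sq_le_sq hle (norm_nonneg _)
  exact (norm_eq_iInf_iff_real_inner_le_zero hX hp).1 (hproj.iInf_eq hp).symm y hy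

lemma norm_sub_sq_add_le_of_isMinOn_proxObjective (hX : Convex ℝ X) (hc : 0 < c) (hp : p ∈ X)
    (hmin : IsMinOn (proxObjective c d z) X p) (hy : y ∈ X) :
    ‖p - y‖ ^ 2 + ‖p - z‖ ^ 2 + 2 * c * inner ℝ d (p - y) ≤ ‖z - y‖ ^ 2 := by
  have hproj := inner_le_zero_of_isMinOn_proxObjective hX hc hp hmin hy
  have hexpand : ‖z - y‖ ^ 2 = ‖p - y‖ ^ 2 + ‖p - z‖ ^ 2 - 2 * inner ℝ (z - p) (y - p) := by
    rw [← sub_sub_sub_cancel_right z y p, norm_sub_sq_real, norm_sub_rev z, norm_sub_rev y]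
    ring
  rw [sub_right_comm, inner_sub_left, real_inner_smul_left, ← neg_sub p y, inner_neg_right,
    inner_neg_right] at hproj
  rw [← neg_sub p y, inner_neg_right] at hexpand
  linarith

lemma norm_sub_sq_add_le_of_isMinOn_proxObjective_add (hX : Convex ℝ X) (hc : 0 < c) (hp : p ∈ X)
    (hmin : IsMinOn (proxObjective c d z) X p) (hy : y ∈ X) (v : V) :
    ‖p - y‖ ^ 2 + ‖p - z‖ ^ 2 + 2 * c * inner ℝ d (v - y) ≤
      ‖z - y‖ ^ 2 + 2 * c * (‖d‖ * ‖p - v‖) := by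
  have hstep := norm_sub_sq_add_le_of_isMinOn_proxObjective hX hc hp hmin hy
  have hcs : inner ℝ d (v - y) ≤ inner ℝ d (p - y) + ‖d‖ * ‖p - v‖ := by
    rw [← sub_le_iff_le_add', ← inner_sub_right, sub_sub_sub_cancel_right, norm_sub_rev]
    exact real_inner_le_norm _ _
  have hscaled := mul_le_mul_of_nonneg_left hcs (by positivity : 0 ≤ 2 * c)
  linarith

end Proximal

section CommonPoint

variable {ι V : Type*} [NormedAddCommGroup V] [NormedSpace ℝ V]

lemma add_smul_sub_mem_of_norm_sub_le {K : Set V} (hK : Convex ℝ K) {a p q : V} {ρ D : ℝ}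
    (hρ : 0 < ρ) (hball : closedBall a ρ ⊆ K) (hp : p ∈ K) (hqp : ‖q - p‖ ≤ D) :
    q + (D / (D + ρ)) • (a - q) ∈ K := by
  have hD : 0 ≤ D := (norm_nonneg _).trans hqp
  rcases hD.eq_or_lt with rfl | hD
  · rw [norm_le_zero_iff, sub_eq_zero] at hqp
    rwa [zero_div, zero_smul, add_zero, hqp]
  have hshift : a + (ρ / D) • (q - p) ∈ K := by
    refine hball (mem_closedBall_iff_norm.2 ?_)
    rw [add_sub_cancel_left, norm_smul, Real.norm_of_nonneg (by positivity), div_mul_eq_mul_div,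
      div_le_iff₀ hD]
    gcongr
  have hcomb : q + (D / (D + ρ)) • (a - q) =
      (ρ / (D + ρ)) • p + (D / (D + ρ)) • (a + (ρ / D) • (q - p)) := by
    have hone : 1 - D / (D + ρ) = ρ / (D + ρ) := by field_simp; ring
    have hweight : D / (D + ρ) * (ρ / D) = ρ / (D + ρ) := by field_simp
    rw [smul_add, smul_smul, hweight, ← hone]
    module
  rw [hcomb]
  exact hK hp hshift (by positivity) (by positivity) (by field_simp; ring)

lemma exists_mem_iInter_norm_sub_le [Finite ι] [Nonempty ι] {X : ι → Set V}
    (hX : ∀ i, Convex ℝ (X i)) (hbdd : ∀ i, Bornology.IsBounded (X i))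
    (hint : (interior (⋂ i, X i)).Nonempty) :
    ∃ μ, 0 ≤ μ ∧ ∀ w : ι → V, (∀ i, w i ∈ X i) →
      ∃ v ∈ ⋂ i, X i, ∀ i, ‖w i - v‖ ≤ μ * diam (Set.range w) := by
  obtain ⟨a, ha⟩ := hint
  obtain ⟨ρ, hρ, hball⟩ := nhds_basis_closedBall.mem_iff.1 (mem_interior_iff_mem_nhds.1 ha)
  obtain ⟨j⟩ := ‹Nonempty ι›
  obtain ⟨R, hR, hsub⟩ := (hbdd j).subset_closedBall_lt 0 a
  refine ⟨1 + R / ρ, by positivity, fun w hw => ?_⟩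
  set D := diam (Set.range w)
  have hD : 0 ≤ D := diam_nonneg
  refine ⟨w j + (D / (D + ρ)) • (a - w j), Set.mem_iInter.2 fun i =>
    add_smul_sub_mem_of_norm_sub_le (hX i) hρ (hball.trans (Set.iInter_subset X i)) (hw i)
      (norm_sub_le_diam_range w j i), fun i => ?_⟩
  calc ‖w i - (w j + (D / (D + ρ)) • (a - w j))‖
      ≤ ‖w i - w j‖ + D / (D + ρ) * ‖a - w j‖ := by
        rw [← sub_sub]
        refine (norm_sub_le _ _).trans_eq ?_
        rw [norm_smul, Real.norm_of_nonneg (by positivity)]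
    _ ≤ D + D / ρ * R := by
        gcongr
        · exact norm_sub_le_diam_range w i j
        · exact le_add_of_nonneg_left hD
        · rw [norm_sub_rev]
          exact mem_closedBall_iff_norm.1 (hsub (hw j))
    _ = (1 + R / ρ) * D := by ring

end CommonPoint

section Subgradient

variable {V : Type*} [NormedAddCommGroup V] [InnerProductSpace ℝ V]

/-- `g` is a subgradient of `h` at `x`, in an arbitrary real inner product space. -/
def IsSubgradientAt (h : V → ℝ) (x g : V) : Prop :=
  ∀ y, h x + inner ℝ g (y - x) ≤ h y

variable {h : V → ℝ} {g : V} {K : ℝ≥0} {s : Set V}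

lemma IsSubgradientAt.norm_le_of_lipschitzOnWith {x : V} (hg : IsSubgradientAt h x g)
    (hh : LipschitzOnWith K h s) (hs : s ∈ 𝓝 x) : ‖g‖ ≤ K := by
  have hray : Tendsto (fun t : ℝ => x + t • g) (𝓝[>] 0) (𝓝 x) := by
    have hcont : Continuous fun t : ℝ => x + t • g := by fun_prop
    simpa only [zero_smul, add_zero] using (hcont.tendsto 0).mono_left nhdsWithin_le_nhds
  obtain ⟨t, hts, ht⟩ := ((hray.eventually_mem hs).and self_mem_nhdsWithin).exists
  replace ht : 0 < t := ht
  have hgrowth : t * ‖g‖ * ‖g‖ ≤ h (x + t • g) - h x := by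
    have hsub := hg (x + t • g)
    rw [add_sub_cancel_left, real_inner_smul_right, real_inner_self_eq_norm_mul_norm] at hsub
    linarith
  have hlip : h (x + t • g) - h x ≤ K * (t * ‖g‖) := by
    have hdist := hh.dist_le_mul _ hts _ (mem_of_mem_nhds hs)
    rw [dist_self_add_left, norm_smul, Real.norm_of_nonneg ht.le] at hdist
    exact (le_abs_self _).trans hdist
  by_contra! hK
  have hpos : 0 < t * ‖g‖ := mul_pos ht (K.2.trans_lt hK)
  nlinarith

lemma IsSubgradientAt.sub_le_inner_add {z : V} (hg : IsSubgradientAt h z g) (hgK : ‖g‖ ≤ K)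
    (hh : LipschitzOnWith K h s) (hz : z ∈ s) {v : V} (hv : v ∈ s) (y : V) :
    h v - h y ≤ inner ℝ g (v - y) + 2 * K * ‖v - z‖ := by
  have hlip : h v - h z ≤ K * ‖v - z‖ := by
    rw [← dist_eq_norm]
    exact (le_abs_self _).trans (hh.dist_le_mul v hv z hz)
  have hinner : -inner ℝ g (v - z) ≤ K * ‖v - z‖ := by
    rw [← inner_neg_right, neg_sub, norm_sub_rev]
    exact (real_inner_le_norm _ _).trans (by gcongr)
  have hsplit : inner ℝ g (v - y) = inner ℝ g (v - z) - inner ℝ g (y - z) := by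
    rw [← inner_sub_right, sub_sub_sub_cancel_right]
  linarith [hg y]

lemma exists_lipschitzOnWith_and_subgradient_norm_le [FiniteDimensional ℝ V] {ι : Type*}
    [Finite ι] {f : ι → V → ℝ} (hf : ∀ i, ConvexOn ℝ Set.univ (f i))
    (hs : Bornology.IsBounded s) :
    ∃ K : ℝ≥0, (∀ i, LipschitzOnWith K (f i) s) ∧
      ∀ i, ∀ x ∈ s, ∀ g, IsSubgradientAt (f i) x g → ‖g‖ ≤ K := by
  have hcompact : IsCompact (closure (thickening 1 s)) := hs.thickening.isCompact_closure
  choose K hK using fun i =>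
    (hf i).locallyLipschitz.locallyLipschitzOn.exists_lipschitzOnWith_of_compact hcompact
  obtain ⟨L, hL⟩ := Finite.bddAbove_range K
  have hlip : ∀ i, LipschitzOnWith L (f i) (closure (thickening 1 s)) := fun i =>
    (hK i).weaken (hL (Set.mem_range_self i))
  have hself : s ⊆ thickening 1 s := self_subset_thickening one_pos s
  refine ⟨L, fun i => (hlip i).mono (hself.trans subset_closure), fun i x hx g hg => ?_⟩
  exact hg.norm_le_of_lipschitzOnWith (hlip i)
    (mem_of_superset (isOpen_thickening.mem_nhds (hself hx)) subset_closure)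

end Subgradient

section DescentStep

lemma sq_norm_le_sum_sq_norm {ι V : Type*} [Fintype ι] [NormedAddCommGroup V] (y : ι → V) :
    ‖y‖ ^ 2 ≤ ∑ i, ‖y i‖ ^ 2 := by
  have hsum : 0 ≤ ∑ i, ‖y i‖ ^ 2 := Finset.sum_nonneg fun i _ => sq_nonneg _
  refine (Real.le_sqrt (norm_nonneg _) hsum).1 ?_
  refine (pi_norm_le_iff_of_nonneg (Real.sqrt_nonneg _)).2 fun i => Real.le_sqrt_of_sq_le ?_
  exact Finset.single_le_sum (f := fun i => ‖y i‖ ^ 2) (fun i _ => sq_nonneg _)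
    (Finset.mem_univ i)

variable {ι V : Type*} [Fintype ι] [NormedAddCommGroup V] [InnerProductSpace ℝ V]
  {c : ℝ} {K : ℝ≥0} {y v : V}

lemma sum_norm_sub_sq_add_le_of_isMinOn_proxObjective {X : ι → Set V} (hX : ∀ i, Convex ℝ (X i))
    (hc : 0 < c) {d z p : ι → V} (hd : ‖d‖ ≤ K) (hp : ∀ i, p i ∈ X i)
    (hmin : ∀ i, IsMinOn (proxObjective c (d i) (z i)) (X i) (p i)) (hy : ∀ i, y ∈ X i) {r : ℝ}
    (hv : ∀ i, ‖p i - v‖ ≤ r) :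
    ∑ i, ‖p i - y‖ ^ 2 + ‖p - z‖ ^ 2 + 2 * c * ∑ i, inner ℝ (d i) (v - y) ≤
      ∑ i, ‖z i - y‖ ^ 2 + Fintype.card ι * (2 * c * (K * r)) := by
  have hagent : ∀ i, ‖p i - y‖ ^ 2 + ‖p i - z i‖ ^ 2 + 2 * c * inner ℝ (d i) (v - y) ≤
      ‖z i - y‖ ^ 2 + 2 * c * (K * r) := by
    intro i
    refine (norm_sub_sq_add_le_of_isMinOn_proxObjective_add (hX i) hc (hp i) (hmin i) (hy i)
      v).trans ?_
    gcongr
    · exact (norm_le_pi_norm d i).trans hd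
    · exact hv i
  have hsum := Finset.sum_le_sum fun i (_ : i ∈ Finset.univ) => hagent i
  simp only [Finset.sum_add_distrib, ← Finset.mul_sum, Finset.sum_const, Finset.card_univ,
    nsmul_eq_mul] at hsum
  have hmove : ‖p - z‖ ^ 2 ≤ ∑ i, ‖p i - z i‖ ^ 2 := sq_norm_le_sum_sq_norm (p - z)
  linarith

variable [DecidableEq ι] {f : ι → V → ℝ} {B : Matrix ι ι ℝ} {s : Set V}

lemma sum_sub_sum_le_sum_inner_average_add (hB : B ∈ rowStochastic ℝ ι) {z g : ι → V}
    (hg : ∀ i, IsSubgradientAt (f i) (z i) (g i)) (hgK : ‖g‖ ≤ K)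
    (hf : ∀ i, LipschitzOnWith K (f i) s) (hz : ∀ i, z i ∈ s) (hv : v ∈ s) {r : ℝ}
    (hvz : ∀ i, ‖v - z i‖ ≤ r) (y : V) :
    ∑ i, f i v - ∑ i, f i y ≤
      ∑ i, inner ℝ (average B g i) (v - y) + Fintype.card ι * (2 * K * r) := by
  rw [← sum_inner, sum_average hB, sum_inner, ← Finset.sum_sub_distrib, ← nsmul_eq_mul,
    ← Finset.card_univ, ← Finset.sum_const, ← Finset.sum_add_distrib]
  refine Finset.sum_le_sum fun i _ => ?_
  refine ((hg i).sub_le_inner_add ((norm_le_pi_norm g i).trans hgK) (hf i) (hz i) hv y).trans ?_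
  gcongr
  exact hvz i

lemma sum_norm_sub_sq_add_le_of_step {X : ι → Set V} (hX : ∀ i, Convex ℝ (X i))
    (hB : B ∈ doublyStochastic ℝ ι) (hc : 0 < c) {x g p : ι → V}
    (hg : ∀ i, IsSubgradientAt (f i) (average B x i) (g i)) (hgK : ‖g‖ ≤ K)
    (hf : ∀ i, LipschitzOnWith K (f i) s) (hz : ∀ i, average B x i ∈ s) (hvs : v ∈ s)
    (hp : ∀ i, p i ∈ X i)
    (hmin : ∀ i, IsMinOn (proxObjective c (average B g i) (average B x i)) (X i) (p i))
    (hy : ∀ i, y ∈ X i) {r : ℝ} (hv : ∀ i, ‖p i - v‖ ≤ r) :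
    ∑ i, ‖p i - y‖ ^ 2 + ‖p - average B x‖ ^ 2 + 2 * c * (∑ i, f i v - ∑ i, f i y) ≤
      ∑ i, ‖x i - y‖ ^ 2 + c * (Fintype.card ι * K) * (6 * r + 4 * ‖p - average B x‖) := by
  obtain ⟨hrow, hcol⟩ := mem_doublyStochastic_iff_mem_rowStochastic_and_mem_colStochastic.1 hB
  have hvz : ∀ i, ‖v - average B x i‖ ≤ r + ‖p - average B x‖ := fun i =>
    (norm_sub_le_norm_sub_add_norm_sub v (p i) _).trans <|
      add_le_add (norm_sub_rev v (p i) ▸ hv i) (norm_le_pi_norm (p - average B x) i)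
  have hprox := sum_norm_sub_sq_add_le_of_isMinOn_proxObjective hX hc
    ((norm_average_le hcol g).trans hgK) hp hmin hy hv
  have hobj := mul_le_mul_of_nonneg_left
    (sum_sub_sum_le_sum_inner_average_add hrow hg hgK hf hz hvs hvz y) (by positivity : 0 ≤ 2 * c)
  have havg := sum_norm_average_sub_sq_le hB x y
  linarith

end DescentStep

/-- The iterates `x` of the subgradient-averaging algorithm for the functions `f i` and the
constraint sets `X i`, with averaging matrices `A k`, step sizes `c k` and subgradients `g k i`. -/
structure IsProxRun {ι V : Type*} [Fintype ι] [NormedAddCommGroup V] [InnerProductSpace ℝ V]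
    (f : ι → V → ℝ) (X : ι → Set V) (A : ℕ → Matrix ι ι ℝ) (c : ℕ → ℝ) (x g : ℕ → ι → V) :
    Prop where
  mem : ∀ k i, x k i ∈ X i
  subgradient : ∀ k i, IsSubgradientAt (f i) (average (A k) (x k) i) (g k i)
  isMinOn : ∀ k i, IsMinOn (proxObjective (c k) (average (A k) (g k) i) (average (A k) (x k) i))
    (X i) (x (k + 1) i)

section Convergence

lemma exists_isMinOn_tendsto_subseq {E : Type*} [PseudoMetricSpace E] {S : Set E} {F : E → ℝ}
    (hS : IsCompact S) (hF : ContinuousOn F S) {v : ℕ → E} (hv : ∀ k, v k ∈ S) {y : E}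
    (hy : IsMinOn F S y) (hgap : ∀ ε > 0, ∃ᶠ k in atTop, F (v k) - F y < ε) :
    ∃ xs ∈ S, IsMinOn F S xs ∧ ∃ φ : ℕ → ℕ,
      Tendsto φ atTop atTop ∧ Tendsto (v ∘ φ) atTop (𝓝 xs) := by
  obtain ⟨ψ, hψ, hψlt⟩ := extraction_forall_of_frequently fun n : ℕ =>
    hgap _ (Nat.one_div_pos_of_nat (α := ℝ) (n := n))
  obtain ⟨xs, hxs, χ, hχ, hlim⟩ := hS.tendsto_subseq fun k => hv (ψ k)
  have hFlim : Tendsto (fun k => F (v (ψ (χ k)))) atTop (𝓝 (F xs)) :=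
    (hF xs hxs).tendsto.comp (tendsto_nhdsWithin_iff.2 ⟨hlim, .of_forall fun k => hv _⟩)
  have hbound : Tendsto (fun k => 1 / ((χ k : ℝ) + 1) + F y) atTop (𝓝 (F y)) := by
    simpa only [Function.comp_def, zero_add] using
      ((tendsto_one_div_add_atTop_nhds_zero_nat (𝕜 := ℝ)).comp hχ.tendsto_atTop).add_const (F y)
  have hle : F xs ≤ F y :=
    le_of_tendsto_of_tendsto' hFlim hbound fun k => (sub_lt_iff_lt_add.1 (hψlt (χ k))).le
  exact ⟨xs, hxs, fun w hw => hle.trans (hy hw), ψ ∘ χ, (hψ.comp hχ).tendsto_atTop, hlim⟩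

lemma tendsto_of_tendsto_sum_norm_sub_sq {ι V : Type*} [Fintype ι] [NormedAddCommGroup V]
    {x : ℕ → ι → V} {v : ℕ → V} {xs : V} {l : ℝ} {φ : ℕ → ℕ}
    (hl : Tendsto (fun k => ∑ i, ‖x k i - xs‖ ^ 2) atTop (𝓝 l))
    (hxv : ∀ i, Tendsto (fun k => x k i - v k) atTop (𝓝 0)) (hφ : Tendsto φ atTop atTop)
    (hv : Tendsto (v ∘ φ) atTop (𝓝 xs)) (i : ι) : Tendsto (fun k => x k i) atTop (𝓝 xs) := by
  have hsub : ∀ j, Tendsto (fun k => x (φ k) j) atTop (𝓝 xs) := fun j => by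
    simpa only [Function.comp_def, sub_add_cancel, zero_add] using ((hxv j).comp hφ).add hv
  have hsub_sq : Tendsto (fun k => ∑ j, ‖x (φ k) j - xs‖ ^ 2) atTop (𝓝 0) := by
    simpa only [sub_self, norm_zero, ne_eq, OfNat.ofNat_ne_zero, not_false_eq_true, zero_pow,
      Finset.sum_const_zero] using
      tendsto_finsetSum Finset.univ fun j _ => ((hsub j).sub_const xs).norm.pow 2
  obtain rfl : l = 0 := tendsto_nhds_unique (hl.comp hφ) hsub_sq
  have hsq : Tendsto (fun k => ‖x k i - xs‖ ^ 2) atTop (𝓝 0) :=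
    squeeze_zero (fun k => sq_nonneg _) (fun k => Finset.single_le_sum
      (f := fun i => ‖x k i - xs‖ ^ 2) (fun i _ => sq_nonneg _) (Finset.mem_univ i)) hl
  rw [tendsto_iff_norm_sub_tendsto_zero]
  simpa only [Real.sqrt_sq (norm_nonneg _), Real.sqrt_zero] using hsq.sqrt

lemma tendsto_zero_of_norm_le_of_summable_sq {V : Type*} [SeminormedAddGroup V] {y : ℕ → V}
    {r : ℕ → ℝ} (hr : ∀ k, 0 ≤ r k) {μ : ℝ} (h : ∀ k, ‖y k‖ ≤ μ * r k)
    (hsum : Summable fun k => r k ^ 2) : Tendsto y atTop (𝓝 0) := by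
  have hr0 : Tendsto r atTop (𝓝 0) := by
    simpa only [Real.sqrt_sq (hr _), Real.sqrt_zero] using hsum.tendsto_atTop_zero.sqrt
  exact squeeze_zero_norm h (by simpa only [mul_zero] using hr0.const_mul μ)

variable {ι V : Type*} [Fintype ι] [DecidableEq ι] [Nonempty ι] [NormedAddCommGroup V]
  [InnerProductSpace ℝ V] [FiniteDimensional ℝ V] {f : ι → V → ℝ} {X : ι → Set V}
  {A : ℕ → Matrix ι ι ℝ} {c : ℕ → ℝ} {x g : ℕ → ι → V}

lemma IsProxRun.exists_sum_norm_sub_sq_add_le (hrun : IsProxRun f X A c x g)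
    (hf : ∀ i, ConvexOn ℝ Set.univ (f i)) (hbdd : ∀ i, Bornology.IsBounded (X i))
    (hX : ∀ i, Convex ℝ (X i)) (hA : ∀ k, A k ∈ doublyStochastic ℝ ι) (hc : ∀ k, 0 < c k)
    {v : ℕ → V} (hvX : ∀ k, v k ∈ ⋂ i, X i) {μ : ℝ} (hμ : 0 ≤ μ)
    (hv : ∀ k i, ‖x k i - v k‖ ≤ μ * diam (Set.range (x k))) :
    ∃ P, ∀ y ∈ ⋂ i, X i, ∀ k,
      ∑ i, ‖x (k + 1) i - y‖ ^ 2 + ‖x (k + 1) - average (A k) (x k)‖ ^ 2 +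
          2 * c k * (∑ i, f i (v (k + 1)) - ∑ i, f i y) ≤
        ∑ i, ‖x k i - y‖ ^ 2 +
          c k * P * (diam (Set.range (x (k + 1))) + ‖x (k + 1) - average (A k) (x k)‖) := by
  set s := convexHull ℝ (⋃ i, X i)
  have hs : Bornology.IsBounded s := isBounded_convexHull.2 (Bornology.isBounded_iUnion.2 hbdd)
  have hXs : ∀ i, X i ⊆ s := fun i => (Set.subset_iUnion X i).trans (subset_convexHull ℝ _)
  obtain ⟨K, hlip, hsub⟩ := exists_lipschitzOnWith_and_subgradient_norm_le hf hs
  refine ⟨Fintype.card ι * K * (6 * μ + 4), fun y hy k => ?_⟩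
  have hcol := (mem_doublyStochastic_iff_mem_rowStochastic_and_mem_colStochastic.1 (hA k)).2
  have hz : ∀ i, average (A k) (x k) i ∈ s := fun i =>
    convexHull_mono (Set.range_subset_iff.2 fun j => Set.mem_iUnion_of_mem j (hrun.mem k j))
      (average_mem_convexHull hcol (x k) i)
  have hvs : v (k + 1) ∈ s := hXs (Classical.arbitrary ι) (Set.mem_iInter.1 (hvX _) _)
  have hgK : ‖g k‖ ≤ K :=
    (pi_norm_le_iff_of_nonneg K.2).2 fun i => hsub i _ (hz i) _ (hrun.subgradient k i)
  refine (sum_norm_sub_sq_add_le_of_step hX (hA k) (hc k) (hrun.subgradient k) hgK hlip hz hvs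
    (hrun.mem (k + 1)) (hrun.isMinOn k) (Set.mem_iInter.1 hy) (hv (k + 1))).trans ?_
  set D := diam (Set.range (x (k + 1)))
  set E := ‖x (k + 1) - average (A k) (x k)‖
  have hcoef : 6 * (μ * D) + 4 * E ≤ (6 * μ + 4) * (D + E) := by
    have hD : 0 ≤ D := diam_nonneg
    have hE : 0 ≤ μ * E := mul_nonneg hμ (norm_nonneg _)
    linarith
  have hscaled := mul_le_mul_of_nonneg_left hcoef
    (mul_nonneg (hc k).le (by positivity : 0 ≤ Fintype.card ι * (K : ℝ)))
  linarith

lemma IsProxRun.summable_and_tendsto (hrun : IsProxRun f X A c x g)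
    (hf : ∀ i, ConvexOn ℝ Set.univ (f i)) (hbdd : ∀ i, Bornology.IsBounded (X i))
    (hX : ∀ i, Convex ℝ (X i)) (hA : ∀ k, A k ∈ doublyStochastic ℝ ι)
    (hconn : UniformlyConnected A) (hc : ∀ k, 0 < c k) (hcs : Summable fun k => c k ^ 2)
    {v : ℕ → V} (hvX : ∀ k, v k ∈ ⋂ i, X i) {μ : ℝ} (hμ : 0 ≤ μ)
    (hv : ∀ k i, ‖x k i - v k‖ ≤ μ * diam (Set.range (x k))) {y : V} (hy : y ∈ ⋂ i, X i)
    (hmin : IsMinOn (fun y => ∑ i, f i y) (⋂ i, X i) y) :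
    Summable (fun k => diam (Set.range (x k)) ^ 2) ∧
      Summable (fun k => c k * (∑ i, f i (v (k + 1)) - ∑ i, f i y)) ∧
      ∃ l, Tendsto (fun k => ∑ i, ‖x k i - y‖ ^ 2) atTop (𝓝 l) := by
  obtain ⟨P, hP⟩ := hrun.exists_sum_norm_sub_sq_add_le hf hbdd hX hA hc hvX hμ hv
  obtain ⟨M, hM, hconsensus⟩ := hconn.exists_sum_diam_sq_le
    (fun k => (mem_doublyStochastic_iff_mem_rowStochastic_and_mem_colStochastic.1 (hA k)).2) x
  have hgap : ∀ k, 0 ≤ ∑ i, f i (v (k + 1)) - ∑ i, f i y := fun k => sub_nonneg.2 (hmin (hvX _))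
  have hlimit := tendsto_and_summable_of_descent
    (u := fun k => ∑ i, ‖x k i - y‖ ^ 2) (a := fun k => diam (Set.range (x k)) ^ 2)
    (b := fun k => ‖x (k + 1) - average (A k) (x k)‖ ^ 2)
    (w := fun k => 2 * c k * (∑ i, f i (v (k + 1)) - ∑ i, f i y))
    (γ := fun k => (2 * (2 * (M + 1))⁻¹)⁻¹ * (c k * P) ^ 2)
    (fun k => Finset.sum_nonneg fun i _ => sq_nonneg _) (fun k => sq_nonneg _)
    (fun k => sq_nonneg _) (fun k => mul_nonneg (mul_nonneg zero_le_two (hc k).le) (hgap k))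
    (fun k => by positivity)
    (by simpa only [mul_pow] using (hcs.mul_right (P ^ 2)).mul_left _) hM
    (fun k => by
      have hyoung := mul_add_le_mul_add_sq (inv_pos.2 (by positivity : 0 < 2 * (M + 1))) (c k * P)
        (diam (Set.range (x (k + 1)))) ‖x (k + 1) - average (A k) (x k)‖
      linarith [hP y hy k])
    hconsensus
  simpa only [mul_assoc, summable_mul_left_iff (two_ne_zero' ℝ)] using hlimit

end Convergence

lemma NetworkAssumptions.uniformlyConnected {m : ℕ} {A : ℕ → Matrix (Fin m) (Fin m) ℝ}
    (hA : NetworkAssumptions A) : UniformlyConnected A := by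
  obtain ⟨η, hη, -, hweight⟩ := hA.weights_bounded_below
  obtain ⟨T, hT⟩ := hA.bounded_communication
  refine ⟨η, hη, T, fun k => (hweight k).1, fun j i =>
    Relation.ReflTransGen.mono (fun j i hji k => ?_) _ _ (hA.strongly_connected j i)⟩
  obtain ⟨l, hkl, hlT, hl⟩ := hT j i hji k
  exact ⟨l, ⟨hkl, hlT⟩, (hweight l).2 j i hl⟩

lemma StepSizeAssumptions.pos {c : ℕ → ℝ} (hc : StepSizeAssumptions c) (k : ℕ) : 0 < c k := by
  refine (hc.nonneg k).lt_of_ne fun h => hc.not_summable ?_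
  refine summable_of_hasFiniteSupport ((Set.finite_lt_nat k).subset fun l hl => ?_)
  by_contra hlk
  exact hl (le_antisymm ((hc.nonincreasing (not_lt.1 hlk)).trans h.ge) (hc.nonneg l))

lemma IsRun.isProxRun {n m : ℕ} {f : Fin m → EuclideanSpace ℝ (Fin n) → ℝ}
    {X : Fin m → Set (EuclideanSpace ℝ (Fin n))} {A : ℕ → Matrix (Fin m) (Fin m) ℝ} {c : ℕ → ℝ}
    {x z g d : ℕ → Fin m → EuclideanSpace ℝ (Fin n)} (hrun : IsRun f X A c x z g d) :
    IsProxRun f X A c x g := by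
  have hz : ∀ k i, z k i = SubgradAvg.average (A k) (x k) i := fun k i =>
    (hrun.average k i).trans (average_apply _ _ _).symm
  have hd : ∀ k i, d k i = SubgradAvg.average (A k) (g k) i := fun k i =>
    (hrun.average_subgradient k i).trans (average_apply _ _ _).symm
  refine ⟨fun k => k.casesOn hrun.init hrun.update_mem, fun k i => hz k i ▸ hrun.subgradient k i,
    fun k i => ?_⟩
  rw [← hz, ← hd]
  exact hrun.update_min k i

end SubgradAvg

theorem theorem1_general {ι V : Type*} [Fintype ι] [DecidableEq ι] [NormedAddCommGroup V]
    [InnerProductSpace ℝ V] [FiniteDimensional ℝ V] {f : ι → V → ℝ} {X : ι → Set V}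
    {A : ℕ → Matrix ι ι ℝ} {c : ℕ → ℝ} {x g : ℕ → ι → V}
    (hf : ∀ i, ConvexOn ℝ Set.univ (f i)) (hXc : ∀ i, IsCompact (X i))
    (hX : ∀ i, Convex ℝ (X i)) (hint : (interior (⋂ i, X i)).Nonempty)
    (hA : ∀ k, A k ∈ doublyStochastic ℝ ι) (hconn : SubgradAvg.UniformlyConnected A)
    (hc : ∀ k, 0 < c k) (hcn : ¬ Summable c) (hcs : Summable fun k => c k ^ 2)
    (hrun : SubgradAvg.IsProxRun f X A c x g) :
    ∃ xs ∈ ⋂ i, X i, IsMinOn (fun y => ∑ i, f i y) (⋂ i, X i) xs ∧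
      ∀ i, Tendsto (fun k => x k i) atTop (𝓝 xs) := by
  rcases isEmpty_or_nonempty ι with hι | hι
  · exact ⟨0, by simp, by simp [isMinOn_iff], fun i => hι.elim i⟩
  have hbdd := fun i => (hXc i).isBounded
  have hS : IsCompact (⋂ i, X i) := (hXc (Classical.arbitrary ι)).of_isClosed_subset
    (isClosed_iInter fun i => (hXc i).isClosed) (Set.iInter_subset X _)
  have hF : Continuous fun y => ∑ i, f i y :=
    continuous_finsetSum _ fun i _ => (hf i).locallyLipschitz.continuous
  obtain ⟨y, hy, hmin⟩ := hS.exists_isMinOn (hint.mono interior_subset) hF.continuousOn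
  obtain ⟨μ, hμ, hnear⟩ := SubgradAvg.exists_mem_iInter_norm_sub_le hX hbdd hint
  choose v hvX hv using fun k => hnear (x k) (hrun.mem k)
  have hdescent {y} := hrun.summable_and_tendsto hf hbdd hX hA hconn hc hcs hvX hμ hv (y := y)
  obtain ⟨hdiam, hgap, -⟩ := hdescent hy hmin
  have hxv := fun i => SubgradAvg.tendsto_zero_of_norm_le_of_summable_sq
    (fun _ => Metric.diam_nonneg) (fun k => hv k i) hdiam
  obtain ⟨xs, hxs, hxsmin, φ, hφ, hlim⟩ := SubgradAvg.exists_isMinOn_tendsto_subseq hS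
    hF.continuousOn (fun k => hvX (k + 1)) hmin fun ε hε =>
      SubgradAvg.frequently_lt_of_summable_mul (fun k => (hc k).le) hcn hgap hε
  obtain ⟨l, hl⟩ := (hdescent hxs hxsmin).2.2
  exact ⟨xs, hxs, hxsmin, SubgradAvg.tendsto_of_tendsto_sum_norm_sub_sq hl hxv
    ((tendsto_add_atTop_nat 1).comp hφ) hlim⟩

theorem theorem1 {n m : ℕ}
    (f : Fin m → EuclideanSpace ℝ (Fin n) → ℝ)
    (X : Fin m → Set (EuclideanSpace ℝ (Fin n)))
    (A : ℕ → Matrix (Fin m) (Fin m) ℝ) (c : ℕ → ℝ)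
    (hfX : SubgradAvg.ProblemAssumptions f X)
    (hA : SubgradAvg.NetworkAssumptions A)
    (hc : SubgradAvg.StepSizeAssumptions c)
    (x z g d : ℕ → Fin m → EuclideanSpace ℝ (Fin n))
    (hrun : SubgradAvg.IsRun f X A c x z g d) :
    ∃ xs : EuclideanSpace ℝ (Fin n), SubgradAvg.IsMinimiser f X xs ∧
      ∀ i, Tendsto (fun k => ‖x k i - xs‖) atTop (𝓝 0) := by
  obtain ⟨xs, hxs, hmin, hlim⟩ := theorem1_general hfX.convex_objective hfX.compact_set
    hfX.convex_set hfX.interior_nonempty hA.doubly_stochastic hA.uniformlyConnected hc.pos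
    hc.not_summable hc.square_summable hrun.isProxRun
  exact ⟨xs, ⟨hxs, fun y hy => hmin hy⟩, fun i => tendsto_iff_norm_sub_tendsto_zero.1 (hlim i)⟩
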